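/- Let $\mathbb{T}$ be the unit circle, let $S^3=\{(z,w)\in\mathbb{C}^2: |z|^2+|w|^2=1\}$, and let $M_n$ be the $C^*$-algebra of complex $n\times n$ matrices. For compact spaces $X,Y$, say that a unital $*$-homomorphism $\phi: C(X)\to C(Y,M_n)$ can be *approximately diagonalized* if for every $\varepsilon>0$ and every compact set $\mathcal{F}\subset C(X)$ there are continuous maps $\alpha_1,\dots,\alpha_n: Y\to X$ and mutually orthogonal projections $p_1,\dots,p_n\in C(Y,M_n)$, each of rank one at every point of $Y$, such that $$\Big\|\phi(f)-\sum_{i=1}^n (f\circ\alpha_i)\,p_i\Big\|<\varepsilon\quad\text{for all } f\in\mathcal{F}.$$ Let $u\in C(S^3,M_2)$ be the function $$u(z,w)=\begin{pmatrix} z & -\bar w\\ w & \bar z\end{pmatrix}.$$ Then $u$ is a unitary, there is exactly one unital $*$-homomorphism $\phi: C(\mathbb{T})\to C(S^3,M_2)$ that sends the identity function of $\mathbb{T}$ to $u$, and this $\phi$ cannot be approximately diagonalized. Moreover, $u$ does not lie in the connected component of the identity in the unitary group of $C(S^3,M_2)$ (with the norm topology), while every continuous map $S^3\to\mathbb{T}$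 is homotopic to a constant map. -/

import Mathlib

open scoped Matrix.Norms.L2Operator

/-- The algebra `M_n` of complex `n × n` matrices; its norm is the C⋆-norm, that is, the operator
norm on the Hilbert space `ℂⁿ`. -/
abbrev MatC (n : ℕ) : Type := Matrix (Fin n) (Fin n) ℂ

/-- `p` is a rank one projection in `C(Y, M_n)`: a self-adjoint idempotent (for the pointwise
operations) every fibre of which has rank one. -/
structure IsRankOneProjection {Y : Type*} [TopologicalSpace Y] {n : ℕ} (p : C(Y, MatC n)) :
    Prop where
  isStarProjection : IsStarProjection p
  rank_eq_one : ∀ y : Y, (p y).rank = 1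

/-- The element `∑ i, f(α_i) p_i` of `C(Y, M_n)`. -/
noncomputable def diagonalSum {X Y : Type*} [TopologicalSpace X] [TopologicalSpace Y] {n : ℕ}
    (α : Fin n → C(Y, X)) (p : Fin n → C(Y, MatC n)) (f : C(X, ℂ)) : C(Y, MatC n) :=
  ∑ i, (f.comp (α i)) • p i

/-- A (unital, ⋆-preserving) homomorphism `φ : C(X) → C(Y, M_n)` can be approximately
diagonalized: for every `ε > 0` and every compact `F ⊆ C(X)` there are continuous maps
`α₁, …, α_n : Y → X` and mutually orthogonal rank one projections `p₁, …, p_n` in `C(Y, M_n)` with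
`‖φ(f) - ∑ i, f(α_i) p_i‖ < ε` for all `f ∈ F`. -/
def ApproximatelyDiagonalizable {X Y : Type*} [TopologicalSpace X] [CompactSpace X]
    [TopologicalSpace Y] [CompactSpace Y] {n : ℕ} (φ : C(X, ℂ) →⋆ₐ[ℂ] C(Y, MatC n)) : Prop :=
  ∀ ε : ℝ, 0 < ε → ∀ F : Set C(X, ℂ), IsCompact F →
    ∃ (α : Fin n → C(Y, X)) (p : Fin n → C(Y, MatC n)),
      (∀ i, IsRankOneProjection (p i)) ∧
      (Pairwise fun i j => p i * p j = 0) ∧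
      ∀ f ∈ F, ‖φ f - diagonalSum α p f‖ < ε

/-- The sphere `S³ = {(z, w) ∈ ℂ² : |z|² + |w|² = 1}`. -/
abbrev SphereThree : Type := Metric.sphere (0 : EuclideanSpace ℂ (Fin 2)) 1

/-- The matrix-valued function `u(z, w) = [[z, -w̄], [w, z̄]]` on `S³`. -/
noncomputable def sphereMatrix : C(SphereThree, MatC 2) where
  toFun y := !![y.1 0, -star (y.1 1); y.1 1, star (y.1 0)]
  continuous_toFun := by
    refine continuous_matrix fun i j => ?_
    fin_cases i <;> fin_cases j <;> simp <;> fun_prop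

/-- The identity function `z ↦ z` on the unit circle, an element of `C(𝕋)`. -/
def circleCoord : C(Circle, ℂ) where
  toFun z := (z : ℂ)
  continuous_toFun := continuous_subtype_val

-- The invariant is extendability: the invertible functions `S³ → M₂` that extend to invertible
-- functions on `ℂ²` form a subgroup. By Tietze it contains the open unit ball around `1`, so it is
-- clopen and contains the identity component (`isClopen_extendableUnits`). It misses `u`: the first
-- column of an extension would be a nowhere zero self-map of `ℂ²` fixing the unit sphere pointwise,
-- against `exists_eq_zero_of_eqOn_sphere`.
--
-- Every map `S³ → 𝕋` has a logarithm, hence is nullhomotopic. So an approximate diagonalization of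
-- `φ` would put `u` within `1` of some `∑ exp(iθ_i) p_i`, which the path `∑ exp(itθ_i) p_i` joins
-- to `1`; then `u` would extend after all. Existence and uniqueness of `φ` come from the continuous
-- functional calculus and Stone–Weierstrass.
--
-- The no-retraction statement is proved analytically. The integral of `det(1 + t g') q(‖x + t g‖²)`
-- is polynomial in `t` and, by change of variables, constant for small `t`, hence also at `t = 1`.
-- Choosing `q` to peak at the origin forces `x + g x` to vanish somewhere.

open MeasureTheory Polynomial Metric Set in
/-- If `t ↦ G t x` is a polynomial of degree at most `d` for every `x`, and the integral of `G t`
does not depend on `t` in an interval `[0, δ]`, then it does not depend on `t` at all. -/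
theorem integral_eq_of_polynomial_of_eq_on_Icc {Ω : Type*} [MeasurableSpace Ω] {μ : Measure Ω}
    {G : ℝ → Ω → ℝ} {d : ℕ} (hG : ∀ x, ∃ p : ℝ[X], p.natDegree ≤ d ∧ ∀ t, p.eval t = G t x)
    (hint : ∀ t, Integrable (G t) μ) {δ C : ℝ} (hδ : 0 < δ)
    (hC : ∀ t ∈ Icc 0 δ, ∫ x, G t x ∂μ = C) (t : ℝ) : ∫ x, G t x ∂μ = C := by
  -- `d + 1` nodes in the interval determine each polynomial; the Lagrange weights do not depend on
  -- `x`, so they pass through the integral.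
  obtain ⟨s, hs, hcard⟩ := (Icc_infinite hδ).exists_subset_card_eq (d + 1)
  have hinj : Set.InjOn (id : ℝ → ℝ) s := Function.injective_id.injOn
  have hne : s.Nonempty := Finset.card_pos.1 (by omega)
  have key : ∀ x, G t x = ∑ i ∈ s, G i x * (Lagrange.basis s id i).eval t := by
    intro x
    obtain ⟨p, hp, hpG⟩ := hG x
    have hdeg : p.degree < s.card := by
      refine lt_of_le_of_lt degree_le_natDegree ?_
      rw [hcard]
      exact_mod_cast Nat.lt_succ_of_le hp
    have := congrArg (eval t) (Lagrange.eq_interpolate hinj hdeg)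
    rw [hpG, Lagrange.interpolate_apply, eval_finsetSum] at this
    simpa [hpG] using this
  simp_rw [key]
  rw [integral_finsetSum _ fun i _ => (hint i).mul_const _]
  simp_rw [integral_mul_const]
  rw [Finset.sum_congr rfl fun i hi => by rw [hC i (hs hi)], ← Finset.mul_sum,
    ← eval_finsetSum, Lagrange.sum_basis hinj hne, eval_one, mul_one]

open Polynomial in
/-- The determinant of `1 + t A` is a polynomial in `t`. -/
theorem exists_polynomial_eval_eq_det_one_add_smul {E : Type*} [NormedAddCommGroup E]
    [NormedSpace ℝ E] [FiniteDimensional ℝ E] (A : E →L[ℝ] E) :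
    ∃ p : ℝ[X], p.natDegree ≤ Module.finrank ℝ E ∧
      ∀ t : ℝ, p.eval t = (ContinuousLinearMap.id ℝ E + t • A).det := by
  classical
  let b := Module.finBasis ℝ E
  let M := LinearMap.toMatrix b b (A : E →ₗ[ℝ] E)
  refine ⟨((X : ℝ[X]) • M.map C + (1 : Matrix _ _ ℝ).map C).det, ?_, fun t => ?_⟩
  · simpa using natDegree_det_X_add_C_le M 1
  · rw [ContinuousLinearMap.det, ← LinearMap.det_toMatrix b, ← coe_evalRingHom, RingHom.map_det]
    congr 1
    have h1 : ((ContinuousLinearMap.id ℝ E + t • A : E →L[ℝ] E) : E →ₗ[ℝ] E) =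
        LinearMap.id + t • (A : E →ₗ[ℝ] E) := rfl
    have h2 : LinearMap.toMatrix b b (LinearMap.id + t • (A : E →ₗ[ℝ] E)) = 1 + t • M := by
      rw [map_add, LinearEquiv.map_smul, LinearMap.toMatrix_id]
    rw [h1, h2]
    ext i j
    simp [Matrix.one_apply, add_comm, apply_ite, mul_comm t]

open Polynomial in
/-- Composing a polynomial with `‖x + t y‖ ^ 2` gives a polynomial in `t`. -/
theorem exists_polynomial_eval_eq_eval_norm_sq {E : Type*} [NormedAddCommGroup E]
    [InnerProductSpace ℝ E] (q : ℝ[X]) (x y : E) :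
    ∃ p : ℝ[X], p.natDegree ≤ q.natDegree * 2 ∧ ∀ t : ℝ, p.eval t = q.eval (‖x + t • y‖ ^ 2) := by
  refine ⟨q.comp (C (‖y‖ ^ 2) * X ^ 2 + C (2 * inner ℝ x y) * X + C (‖x‖ ^ 2)), ?_, fun t => ?_⟩
  · refine natDegree_comp_le.trans (Nat.mul_le_mul_left _ natDegree_quadratic_le)
  · rw [eval_comp]
    congr 1
    simp only [eval_add, eval_mul, eval_pow, eval_X, eval_C]
    rw [norm_add_sq_real, norm_smul, inner_smul_right, Real.norm_eq_abs, mul_pow, sq_abs]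
    ring

-- Points outside the ball are fixed, so a bijection cannot exchange them with points inside.
open Set Metric in
theorem image_closedBall_add_smul {E : Type*} [NormedAddCommGroup E] [NormedSpace ℝ E]
    {g : E → E} {R t : ℝ} (hg : ∀ x, x ∉ closedBall (0 : E) R → g x = 0)
    (hbij : Function.Bijective fun x => x + t • g x) :
    (fun x => x + t • g x) '' closedBall 0 R = closedBall 0 R := by
  have hfix : ∀ x, x ∉ closedBall (0 : E) R → x + t • g x = x := fun x hx => by simp [hg x hx]
  apply Subset.antisymm
  · rintro _ ⟨x, hx, rfl⟩
    by_contra hy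
    exact hy ((hbij.1 (hfix _ hy)).symm ▸ hx)
  · intro y hy
    obtain ⟨x, rfl⟩ := hbij.2 y
    refine ⟨x, ?_, rfl⟩
    by_contra hx
    exact hx (by simpa [hfix x hx] using hy)

-- Degree of a perturbation of the identity, and no retraction

section Degree

variable {E : Type*} [NormedAddCommGroup E] [InnerProductSpace ℝ E] [FiniteDimensional ℝ E]

open Set Metric in
/-- A small Lipschitz perturbation of the identity is bijective. -/
theorem bijective_add_smul_of_lipschitzWith {g : E → E} {K : NNReal} (hK : LipschitzWith K g)
    {t : ℝ} (ht : |t| * K < 1) : Function.Bijective fun x => x + t • g x := by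
  have happ : ApproximatesLinearOn (fun x => x + t • g x)
      ((ContinuousLinearEquiv.refl ℝ E : E ≃L[ℝ] E) : E →L[ℝ] E) univ (‖t‖₊ * K) := by
    intro x _ y _
    have h1 : x + t • g x - (y + t • g y) - (x - y) = t • (g x - g y) := by
      rw [smul_sub]; abel
    simp only [ContinuousLinearEquiv.coe_refl, ContinuousLinearMap.coe_id', id_eq]
    rw [h1, norm_smul, NNReal.coe_mul, mul_assoc, coe_nnnorm]
    exact mul_le_mul_of_nonneg_left (hK.norm_sub_le x y) (norm_nonneg _)
  have hc : Subsingleton E ∨ ‖t‖₊ * K <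
      ‖((ContinuousLinearEquiv.refl ℝ E).symm : E →L[ℝ] E)‖₊⁻¹ := by
    rcases subsingleton_or_nontrivial E with h | h
    · exact Or.inl h
    · right
      have : ‖((ContinuousLinearEquiv.refl ℝ E).symm : E →L[ℝ] E)‖₊ = 1 := by
        simp
      rw [this, inv_one, ← NNReal.coe_lt_coe]
      simpa using ht
  exact (happ.toHomeomorph _ hc).bijective

open MeasureTheory Set Metric Polynomial

/-- The degree of a compactly supported perturbation of the identity is one: the change of
variables formula for `x ↦ x + g x` without absolute values and without injectivity. -/
theorem integral_det_one_add_fderiv_mul_eval_norm_sq [MeasurableSpace E] [BorelSpace E]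
    (μ : Measure E) [μ.IsAddHaarMeasure] {g : E → E} (hg : ContDiff ℝ 1 g) {R : ℝ}
    (hsupp : ∀ x, x ∉ closedBall (0 : E) R → g x = 0) (q : ℝ[X]) :
    ∫ x in closedBall 0 R, (ContinuousLinearMap.id ℝ E + fderiv ℝ g x).det *
        q.eval (‖x + g x‖ ^ 2) ∂μ = ∫ x in closedBall 0 R, q.eval (‖x‖ ^ 2) ∂μ := by
  have hcomp : IsCompact (closedBall (0 : E) R) := isCompact_closedBall _ _
  have hcs : HasCompactSupport g := HasCompactSupport.intro hcomp hsupp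
  obtain ⟨K, hK⟩ := ContDiff.lipschitzWith_of_hasCompactSupport hcs hg one_ne_zero
  let G : ℝ → E → ℝ := fun t x => (ContinuousLinearMap.id ℝ E + t • fderiv ℝ g x).det *
        q.eval (‖x + t • g x‖ ^ 2)
  have hfd : Continuous (fderiv ℝ g) := hg.continuous_fderiv one_ne_zero
  have hgc : Continuous g := hg.continuous
  have hdetc : Continuous fun A : E →L[ℝ] E => A.det := ContinuousLinearMap.continuous_det
  have hGc : ∀ t, Continuous (G t) := fun t =>
    (hdetc.comp (by fun_prop)).mul (q.continuous.comp (by fun_prop))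
  have hpoly : ∀ x, ∃ p : ℝ[X], p.natDegree ≤ Module.finrank ℝ E + q.natDegree * 2 ∧
      ∀ t, p.eval t = G t x := by
    intro x
    obtain ⟨p₁, h₁, e₁⟩ := exists_polynomial_eval_eq_det_one_add_smul (fderiv ℝ g x)
    obtain ⟨p₂, h₂, e₂⟩ := exists_polynomial_eval_eq_eval_norm_sq q x (g x)
    exact ⟨p₁ * p₂, natDegree_mul_le.trans (add_le_add h₁ h₂), fun t => by
      rw [eval_mul, e₁, e₂]⟩
  -- Near the identity the determinant is positive, so the absolute value in the change of variables
  -- formula disappears.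
  obtain ⟨ε, hε, hεdet⟩ : ∃ ε > 0, ∀ A : E →L[ℝ] E, ‖A‖ < ε →
      0 < (ContinuousLinearMap.id ℝ E + A).det := by
    have hop : IsOpen {A : E →L[ℝ] E | 0 < (ContinuousLinearMap.id ℝ E + A).det} :=
      isOpen_lt continuous_const (hdetc.comp (by fun_prop))
    obtain ⟨ε, hε, h⟩ := Metric.isOpen_iff.1 hop 0 (by simp [ContinuousLinearMap.det])
    exact ⟨ε, hε, fun A hA => h (by simpa using hA)⟩
  let δ : ℝ := min ε 1 / (2 * (K + 1))
  have hδ : 0 < δ := by positivity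
  have hsmall : ∀ t ∈ Icc 0 δ, |t| * K < min ε 1 := by
    rintro t ⟨h0, h1⟩
    rw [abs_of_nonneg h0]
    have hm : 0 < min ε 1 := by positivity
    have hK0 : (0 : ℝ) ≤ K := K.2
    calc t * K ≤ δ * (K + 1) := by gcongr; linarith
      _ = min ε 1 / 2 := by simp only [δ]; field_simp
      _ < min ε 1 := by linarith
  have hconst : ∀ t ∈ Icc 0 δ, ∫ x in closedBall 0 R, G t x ∂μ =
      ∫ x in closedBall 0 R, q.eval (‖x‖ ^ 2) ∂μ := by
    intro t ht
    have hbij := bijective_add_smul_of_lipschitzWith hK ((hsmall t ht).trans_le (min_le_right _ _))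
    have hder : ∀ x ∈ closedBall (0 : E) R, HasFDerivWithinAt (fun x => x + t • g x)
        (ContinuousLinearMap.id ℝ E + t • fderiv ℝ g x) (closedBall 0 R) x := fun x _ =>
      ((hasFDerivAt_id x).add
        ((hg.differentiable one_ne_zero x).hasFDerivAt.const_smul t)).hasFDerivWithinAt
    have := integral_image_eq_integral_abs_det_fderiv_smul μ measurableSet_closedBall hder
      hbij.1.injOn (fun y => q.eval (‖y‖ ^ 2))
    rw [image_closedBall_add_smul hsupp hbij] at this
    rw [this]
    congr 1
    ext x
    rw [abs_of_pos, smul_eq_mul]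
    apply hεdet
    rw [norm_smul, Real.norm_eq_abs]
    exact lt_of_le_of_lt (mul_le_mul_of_nonneg_left (norm_fderiv_le_of_lipschitz ℝ hK)
      (abs_nonneg t)) ((hsmall t ht).trans_le (min_le_left _ _))
  simpa [G] using integral_eq_of_polynomial_of_eq_on_Icc hpoly
    (fun t => (hGc t).continuousOn.integrableOn_compact hcomp) hδ hconst 1

/-- A continuously differentiable self-map of `E` that is the identity outside a compact set has a
zero. -/
theorem exists_add_eq_zero_of_contDiff {g : E → E} (hg : ContDiff ℝ 1 g)
    (hcs : HasCompactSupport g) : ∃ x, x + g x = 0 := by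
  by_contra! hne
  borelize E
  let μ : Measure E := Measure.addHaar
  obtain ⟨R, hR, hsub⟩ := hcs.isCompact.isBounded.subset_closedBall_lt 0 0
  have hsupp : ∀ x, x ∉ closedBall (0 : E) R → g x = 0 := fun x hx =>
    image_eq_zero_of_notMem_tsupport fun h => hx (hsub h)
  set B := closedBall (0 : E) R with hB
  have hcomp : IsCompact B := isCompact_closedBall _ _
  have hgc : Continuous g := hg.continuous
  have hfd : Continuous (fderiv ℝ g) := hg.continuous_fderiv one_ne_zero
  have hdetc : Continuous fun A : E →L[ℝ] E => A.det := ContinuousLinearMap.continuous_det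
  obtain ⟨D, hD⟩ := hcomp.exists_bound_of_continuousOn
    (f := fun x => (ContinuousLinearMap.id ℝ E + fderiv ℝ g x).det)
    (hdetc.comp (by fun_prop)).continuousOn
  obtain ⟨M₀, hM₀⟩ := hcomp.exists_bound_of_continuousOn (f := fun x => x + g x)
    (by fun_prop)
  have h0B : (0 : E) ∈ B := by simp [hB, hR.le]
  have hD0 : 0 ≤ D := (norm_nonneg _).trans (hD 0 h0B)
  obtain ⟨x₀, hx₀, hmin⟩ := hcomp.exists_isMinOn ⟨0, h0B⟩
    (f := fun x => ‖x + g x‖) (by fun_prop)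
  -- Capping by `R` keeps the ball of radius `c / 2` inside `B`.
  let c := min ‖x₀ + g x₀‖ R
  have hc : 0 < c := lt_min (norm_pos_iff.2 (hne _)) hR
  have hcle : ∀ x ∈ B, c ≤ ‖x + g x‖ := fun x hx => (min_le_left _ _).trans (hmin hx)
  let M := max M₀ R
  have hM : 0 < M := hR.trans_le (le_max_right _ _)
  have hcM : c ≤ M := (min_le_right _ _).trans (le_max_right _ _)
  -- On `B`, `a` bounds `1 - ‖x + g x‖² / M²` from above; on the ball of radius `c / 2`, `b` bounds
  -- `1 - ‖x‖² / M²` from below. As `a < b`, the `N`-th powers separate geometrically.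
  let a : ℝ := 1 - c ^ 2 / M ^ 2
  let b : ℝ := 1 - (c / 2) ^ 2 / M ^ 2
  have ha : 0 ≤ a := by
    have : c ^ 2 / M ^ 2 ≤ 1 := by
      rw [div_le_one (by positivity)]; gcongr
    simp only [a]; linarith
  have hab : a < b := by
    have : (c / 2) ^ 2 / M ^ 2 < c ^ 2 / M ^ 2 := by gcongr; linarith
    simp only [a, b]; linarith
  have hb : 0 < b := ha.trans_lt hab
  let V := μ.real (ball 0 (c / 2))
  have hV : 0 < V := by
    refine ENNReal.toReal_pos (measure_ball_pos μ _ (by positivity)).ne' measure_ball_lt_top.ne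
  have key : ∀ N : ℕ, V * b ^ N ≤ D * a ^ N * μ.real B := by
    intro N
    let q : ℝ[X] := (1 - C ((M ^ 2)⁻¹) * X) ^ N
    have hq : ∀ s, q.eval s = (1 - s / M ^ 2) ^ N := fun s => by
      simp [q, div_eq_inv_mul]
    have hdeg := integral_det_one_add_fderiv_mul_eval_norm_sq μ hg hsupp q
    rw [← hB] at hdeg
    simp_rw [hq] at hdeg
    have hnn : ∀ s, 0 ≤ s → s ≤ M → 0 ≤ 1 - s ^ 2 / M ^ 2 := fun s h0 h1 => by
      have : s ^ 2 / M ^ 2 ≤ 1 := by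
        rw [div_le_one (by positivity)]; gcongr
      linarith
    have hint : IntegrableOn (fun x : E => (1 - ‖x‖ ^ 2 / M ^ 2) ^ N) B μ :=
      Continuous.continuousOn (by fun_prop) |>.integrableOn_compact hcomp
    have hballB : ball (0 : E) (c / 2) ⊆ B := fun x hx => by
      have h1 : ‖x‖ < c / 2 := by simpa using hx
      have h2 : c ≤ R := min_le_right _ _
      simp only [hB, mem_closedBall, dist_zero_right]
      linarith
    calc V * b ^ N = ∫ x in ball (0 : E) (c / 2), b ^ N ∂μ := by simp [V]
      _ ≤ ∫ x in ball (0 : E) (c / 2), (1 - ‖x‖ ^ 2 / M ^ 2) ^ N ∂μ := by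
        refine setIntegral_mono_on (integrableOn_const measure_ball_lt_top.ne) (hint.mono_set hballB) measurableSet_ball
          fun x hx => ?_
        have h1 : ‖x‖ < c / 2 := by simpa using hx
        simp only [b] at hb ⊢
        gcongr
      _ ≤ ∫ x in B, (1 - ‖x‖ ^ 2 / M ^ 2) ^ N ∂μ := by
        refine setIntegral_mono_set hint ?_ hballB.eventuallyLE
        refine (ae_restrict_iff' measurableSet_closedBall).2 (ae_of_all _ fun x hx => ?_)
        have h1 : ‖x‖ ≤ R := by simpa [hB] using hx
        exact pow_nonneg (hnn _ (norm_nonneg _) (h1.trans (le_max_right _ _))) _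
      _ ≤ ‖∫ x in B, (ContinuousLinearMap.id ℝ E + fderiv ℝ g x).det *
          (1 - ‖x + g x‖ ^ 2 / M ^ 2) ^ N ∂μ‖ := by
        rw [hdeg]; exact le_abs_self _
      _ ≤ D * a ^ N * μ.real B := by
        refine norm_setIntegral_le_of_norm_le_const hcomp.measure_lt_top fun x hx => ?_
        rw [norm_mul, norm_pow, Real.norm_eq_abs (1 - _), abs_of_nonneg
          (hnn _ (norm_nonneg _) ((hM₀ x hx).trans (le_max_left _ _)))]
        have := hcle x hx
        have h3 := hnn _ (norm_nonneg _) ((hM₀ x hx).trans (le_max_left _ _))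
        gcongr
        · exact hD x hx
        · simp only [a]; gcongr
  have hlim : Filter.Tendsto (fun N : ℕ => D * μ.real B * (a / b) ^ N) Filter.atTop (nhds 0) := by
    simpa using (tendsto_pow_atTop_nhds_zero_of_lt_one (div_nonneg ha hb.le)
      ((div_lt_one hb).2 hab)).const_mul (D * μ.real B)
  refine absurd (ge_of_tendsto' hlim fun N => ?_) (not_le.2 hV)
  rw [div_pow, ← mul_div_assoc, le_div_iff₀ (by positivity)]
  linarith [key N]

/-- A continuous self-map of `E` that restricts to the identity on the unit sphere has a zero. -/
theorem exists_eq_zero_of_eqOn_sphere {f : E → E} (hf : Continuous f)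
    (hid : ∀ x, ‖x‖ = 1 → f x = x) : ∃ x, f x = 0 := by
  by_contra! hne
  let h : E → E := fun x => if ‖x‖ ≤ 1 then f x - x else 0
  have hh : Continuous h := by
    refine Continuous.if_le (by fun_prop) continuous_const (by fun_prop) continuous_const ?_
    intro x hx
    simp [hid x hx]
  have hfun : ∀ x, x + h x ≠ 0 := by
    intro x
    by_cases hx : ‖x‖ ≤ 1
    · simpa [h, hx] using hne x
    · simp only [h, hx, if_false, add_zero]
      rintro rfl
      simp at hx
  have hcs : HasCompactSupport h := HasCompactSupport.intro (isCompact_closedBall 0 1)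
    fun x hx => if_neg (by simpa using hx)
  -- With this tolerance, a zero of `x + g x` would put `g x = -x` at distance exactly `‖x + h x‖`
  -- from `h x`, against the strict bound.
  obtain ⟨g, hg, happ, hsupp⟩ := hh.exists_contDiff_approx 1 (ε := fun x => ‖x + h x‖)
    (by fun_prop) fun x => norm_pos_iff.2 (hfun x)
  obtain ⟨x, hx⟩ := exists_add_eq_zero_of_contDiff hg (hcs.mono hsupp)
  have := happ x
  rw [dist_eq_norm, eq_neg_of_add_eq_zero_right hx, ← norm_neg] at this
  simp [add_comm] at this

end Degree

open scoped Matrix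

-- Invertible functions that extend

section Extension

variable {X : Type*} [TopologicalSpace X] {A : Type*} [NormedRing A] [NormedAlgebra ℂ A]

/-- The group of invertible `A`-valued functions on `S` that extend to invertible `A`-valued
functions on `X`. -/
def extendableUnits (A : Type*) [NormedRing A] [NormedAlgebra ℂ A] (S : Set X) :
    Subgroup C(S, A)ˣ :=
  (Units.map (ContinuousMap.compRightAlgHom ℂ A (⟨Subtype.val, continuous_subtype_val⟩ : C(S, X)) :
    C(X, A) →* C(S, A))).range

theorem mem_extendableUnits_of_norm_sub_one_lt [NormalSpace X] [CompleteSpace A]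
    [FiniteDimensional ℂ A] {S : Set X} [CompactSpace S] (hS : IsClosed S) (a : C(S, A)ˣ)
    (ha : ‖(a : C(S, A)) - 1‖ < 1) : a ∈ extendableUnits A S := by
  -- Norm-preserving Tietze: the extension of `a - 1` keeps norm below `1`, so `1 + g` is invertible
  -- everywhere.
  obtain ⟨g, hg, hgS⟩ := BoundedContinuousFunction.exists_norm_eq_domRestrict_eq hS ℂ
    (BoundedContinuousFunction.mkOfCompact ((a : C(S, A)) - 1))
  rw [BoundedContinuousFunction.norm_mkOfCompact] at hg
  let h : C(X, A) := 1 + (g : C(X, A))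
  have hu : ∀ x, IsUnit (h x) := fun x => by
    have : ‖-(g x)‖ < 1 := by
      rw [norm_neg]; exact (g.norm_coe_le_norm x).trans_lt (hg ▸ ha)
    simpa [h] using isUnit_one_sub_of_norm_lt_one this
  obtain ⟨U, hU⟩ := (ContinuousMap.isUnit_iff_forall_isUnit h).2 hu
  refine ⟨U, ?_⟩
  ext x
  have := congrArg (fun f => f x) hgS
  have h2 : g x = (a : C(S, A)) x - 1 := by simpa using! this
  simp [hU, h, h2]

/-- A subgroup containing a neighbourhood of `1` is open, hence closed. -/
theorem isClopen_extendableUnits [NormalSpace X] [CompleteSpace A]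
    [FiniteDimensional ℂ A] {S : Set X} [CompactSpace S] (hS : IsClosed S) :
    IsClopen (extendableUnits A S : Set C(S, A)ˣ) := by
  have hop : IsOpen (extendableUnits A S : Set C(S, A)ˣ) := by
    refine Subgroup.isOpen_of_mem_nhds (g := 1) _ ?_
    have hlt : ∀ᶠ a : C(S, A)ˣ in nhds 1, ‖(a : C(S, A)) - 1‖ < 1 := by
      have hc : Continuous fun a : C(S, A)ˣ => ‖(a : C(S, A)) - 1‖ :=
        (Units.continuous_val.sub continuous_const).norm
      exact hc.continuousAt.eventually_lt continuousAt_const (by simp)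
    exact hlt.mono fun a ha => mem_extendableUnits_of_norm_sub_one_lt hS a ha
  exact ⟨Subgroup.isClosed_of_isOpen _ hop, hop⟩

end Extension

-- The unitary `u` does not extend

/-- The function `u` is a unitary of `C(S³, M₂)`. -/
theorem sphereMatrix_mem_unitary : sphereMatrix ∈ unitary C(SphereThree, MatC 2) := by
  have hS : ∀ y : SphereThree, y.1 0 * star (y.1 0) + y.1 1 * star (y.1 1) = 1 := by
    intro y
    have h := EuclideanSpace.norm_sq_eq (y.1)
    rw [norm_eq_of_mem_sphere y, Fin.sum_univ_two] at h
    simp only [RCLike.star_def, RCLike.mul_conj]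
    rw [one_pow] at h
    simpa using (congrArg (Complex.ofReal) h).symm
  have h1 : star sphereMatrix * sphereMatrix = 1 := by
    ext y i j
    have := hS y
    fin_cases i <;> fin_cases j <;>
      simp [sphereMatrix, Matrix.star_eq_conjTranspose, Matrix.mul_apply, Fin.sum_univ_two] at this ⊢ <;>
      first | linear_combination this | ring
  have h2 : sphereMatrix * star sphereMatrix = 1 := by
    ext y i j
    have := hS y
    fin_cases i <;> fin_cases j <;>
      simp [sphereMatrix, Matrix.star_eq_conjTranspose, Matrix.mul_apply, Fin.sum_univ_two] at this ⊢ <;>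
      first | linear_combination this | ring
  exact Unitary.mem_iff.2 ⟨h1, h2⟩

theorem notMem_extendableUnits_of_eq_sphereMatrix {a : C(SphereThree, MatC 2)ˣ}
    (ha : (a : C(SphereThree, MatC 2)) = sphereMatrix) :
    a ∉ extendableUnits (MatC 2) (Metric.sphere (0 : EuclideanSpace ℂ (Fin 2)) 1) := by
  rintro ⟨F, rfl⟩
  -- The first column of `u` at `(z, w)` is `(z, w)` itself.
  let f : EuclideanSpace ℂ (Fin 2) → EuclideanSpace ℂ (Fin 2) := fun x =>
    WithLp.toLp 2 ((F : C(EuclideanSpace ℂ (Fin 2), MatC 2)) x *ᵥ ![1, 0])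
  have hf : Continuous f := by
    refine (PiLp.continuous_toLp 2 _).comp ?_
    exact (map_continuous F.1).matrix_mulVec continuous_const
  obtain ⟨x, hx⟩ := exists_eq_zero_of_eqOn_sphere hf fun x hx => by
    have := congrArg (fun g => g ⟨x, by simpa using hx⟩) ha
    have h2 : (F : C(EuclideanSpace ℂ (Fin 2), MatC 2)) x = !![x 0, -star (x 1); x 1, star (x 0)] :=
      this
    ext i
    fin_cases i <;> simp [f, h2, Matrix.mulVec, dotProduct]
  have hu : IsUnit ((F : C(EuclideanSpace ℂ (Fin 2), MatC 2)) x) :=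
    ContinuousMap.isUnit_iff_forall_isUnit _ |>.1 F.isUnit x
  have hx' : (F : C(EuclideanSpace ℂ (Fin 2), MatC 2)) x *ᵥ ![1, 0] = 0 := by
    simpa [f] using hx
  have := (Matrix.mulVec_injective_iff_isUnit.2 hu) (hx'.trans (Matrix.mulVec_zero _).symm)
  simpa using congrFun this 0

theorem sphereMatrix_notMem_connectedComponent_one :
    (⟨sphereMatrix, sphereMatrix_mem_unitary⟩ : unitary C(SphereThree, MatC 2)) ∉
      connectedComponent (1 : unitary C(SphereThree, MatC 2)) := by
  intro h
  have hcont : Continuous (Unitary.toUnits : unitary C(SphereThree, MatC 2) → _) :=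
    Units.continuous_iff.2 ⟨continuous_subtype_val, continuous_subtype_val.star⟩
  have hclopen := (isClopen_extendableUnits (A := MatC 2)
    (Metric.isClosed_sphere (x := (0 : EuclideanSpace ℂ (Fin 2))) (ε := 1))).preimage hcont
  refine notMem_extendableUnits_of_eq_sphereMatrix ?_
    (hclopen.connectedComponent_subset (by simp) h)
  rfl

-- Logarithms of circle-valued maps on spheres

section CircleLift

variable {E : Type*} [NormedAddCommGroup E] [InnerProductSpace ℝ E]

open Metric

/-- A circle-valued map on a sphere has a continuous logarithm away from a point. -/
theorem exists_continuousOn_circleExp_eq (g : C(sphere (0 : E) 1, Circle)) (v : sphere (0 : E) 1) :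
    ∃ θ : sphere (0 : E) 1 → ℝ, ContinuousOn θ {v}ᶜ ∧ ∀ x ≠ v, Circle.exp (θ x) = g x := by
  have hv : ‖(v : E)‖ = 1 := norm_eq_of_mem_sphere v
  let σ : C((ℝ ∙ (v : E))ᗮ, sphere (0 : E) 1) := ⟨stereoInvFun hv, continuous_stereoInvFun hv⟩
  obtain ⟨t, ht⟩ := Circle.exp_surjective (g (σ 0))
  -- Stereographic coordinates live in a vector space, which is simply connected, so the map lifts
  -- through the covering `Circle.exp`.
  obtain ⟨F, ⟨-, hF⟩, -⟩ := Circle.isCoveringMap_exp.existsUnique_continuousMap_lifts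
    (g.comp σ) 0 t ht
  refine ⟨fun x => F (stereographic hv x), ?_, fun x hx => ?_⟩
  · refine F.continuous.comp_continuousOn ?_
    have := (stereographic hv).continuousOn
    rwa [stereographic_source] at this
  · have h1 := congrFun hF (stereographic hv x)
    have h2 : σ (stereographic hv x) = x :=
      (stereographic hv).left_inv (by simpa [stereographic_source] using hx)
    simpa [h2] using h1

/-- Stereographic projection from `v` sends `-v` to `0`, and a punctured space of dimension at least
two is connected. -/
theorem isPreconnected_compl_pair_sphere (h : 2 < Module.finrank ℝ E) (v : sphere (0 : E) 1) :
    IsPreconnected ({v, -v}ᶜ : Set (sphere (0 : E) 1)) := by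
  have hv : ‖(v : E)‖ = 1 := norm_eq_of_mem_sphere v
  have : FiniteDimensional ℝ E := Module.finite_of_finrank_pos (by omega)
  have hrank : 1 < Module.rank ℝ (ℝ ∙ (v : E))ᗮ := by
    rw [← Module.finrank_eq_rank]
    have h1 := Submodule.finrank_add_finrank_orthogonal (ℝ ∙ (v : E))
    rw [finrank_span_singleton (ne_zero_of_mem_unit_sphere v)] at h1
    exact_mod_cast (by omega : 1 < Module.finrank ℝ (ℝ ∙ (v : E))ᗮ)
  have himg : stereoInvFun hv '' {0}ᶜ = {v, -v}ᶜ := by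
    have hneg : stereographic hv (-v) = 0 := stereographic_apply_neg v
    ext x
    simp only [Set.mem_image, Set.mem_compl_iff, Set.mem_singleton_iff, Set.mem_insert_iff, not_or]
    constructor
    · rintro ⟨w, hw, rfl⟩
      refine ⟨fun h => stereoInvFun_ne_north_pole hv w (by simpa using h), fun h => hw ?_⟩
      rw [← hneg, ← h]
      exact ((stereographic hv).right_inv (by simp)).symm
    · rintro ⟨h1, h2⟩
      have hx : stereoInvFun hv (stereographic hv x) = x :=
        (stereographic hv).left_inv (by simpa [stereographic_source] using h1)
      refine ⟨stereographic hv x, fun h0 => h2 ?_, hx⟩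
      rw [← hx, h0, ← hneg]
      refine (stereographic hv).left_inv ?_
      simpa [stereographic_source] using (ne_neg_of_mem_unit_sphere ℝ v).symm
  rw [← himg]
  exact (isConnected_compl_singleton_of_one_lt_rank hrank 0).isPreconnected.image _
    (continuous_stereoInvFun hv).continuousOn

/-- Every continuous map from a sphere of dimension at least two to the circle has a continuous
logarithm. -/
theorem exists_circleExp_comp_eq (h : 2 < Module.finrank ℝ E) (g : C(sphere (0 : E) 1, Circle)) :
    ∃ θ : C(sphere (0 : E) 1, ℝ), ∀ x, Circle.exp (θ x) = g x := by
  classical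
  rcases isEmpty_or_nonempty (sphere (0 : E) 1) with hE | ⟨⟨v⟩⟩
  · exact ⟨0, fun x => isEmptyElim x⟩
  have hvne : v ≠ -v := ne_neg_of_mem_unit_sphere ℝ v
  obtain ⟨θ₁, hc₁, h₁⟩ := exists_continuousOn_circleExp_eq g v
  obtain ⟨θ₂, hc₂, h₂⟩ := exists_continuousOn_circleExp_eq g (-v)
  -- On the connected overlap two lifts differ by a constant in the kernel of `Circle.exp`; shifting
  -- `θ₂` by it makes them glue.
  obtain ⟨c, hc, heq⟩ : ∃ c : ℝ, Circle.exp c = 1 ∧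
      Set.EqOn θ₁ (fun x => θ₂ x + c) {v, -v}ᶜ := by
    rcases Set.eq_empty_or_nonempty ({v, -v}ᶜ : Set (sphere (0 : E) 1)) with he | ⟨a, ha⟩
    · exact ⟨0, by simp, by simp [he]⟩
    have hav : a ≠ v ∧ a ≠ -v := by simpa using ha
    have hexp : Circle.exp (θ₁ a - θ₂ a) = 1 := by
      rw [Circle.exp_sub, h₁ a hav.1, h₂ a hav.2, div_self']
    refine ⟨θ₁ a - θ₂ a, hexp, ?_⟩
    refine Circle.isCoveringMap_exp.eqOn_of_comp_eqOn (isPreconnected_compl_pair_sphere h v)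
      (hc₁.mono fun x hx => ?_) ((hc₂.add continuousOn_const).mono fun x hx => ?_)
      (fun x hx => ?_) ha (by ring)
    · exact fun h => hx (Or.inl h)
    · exact fun h => hx (Or.inr h)
    · have hxv : x ≠ v ∧ x ≠ -v := by simpa using hx
      simp only [Function.comp_apply, Circle.exp_add, hexp, mul_one]
      rw [h₁ x hxv.1, h₂ x hxv.2]
  let θ : sphere (0 : E) 1 → ℝ := fun x => if x = v then θ₂ x + c else θ₁ x
  have hθ₂ : Set.EqOn θ (fun x => θ₂ x + c) {-v}ᶜ := fun x hx => by
    by_cases hxv : x = v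
    · simp [θ, hxv]
    · simp only [θ, hxv, if_false]
      exact heq (by simpa using ⟨hxv, hx⟩)
  have hθ₁ : Set.EqOn θ θ₁ {v}ᶜ := fun x hx => if_neg hx
  have hcont : Continuous θ := by
    refine continuous_iff_continuousAt.2 fun x => ?_
    by_cases hxv : x = v
    · have hx : ({-v}ᶜ : Set (sphere (0 : E) 1)) ∈ nhds x :=
        isOpen_compl_singleton.mem_nhds (by simpa [hxv] using hvne)
      exact ((hc₂.add continuousOn_const).congr hθ₂).continuousAt hx
    · exact (hc₁.congr hθ₁).continuousAt (isOpen_compl_singleton.mem_nhds hxv)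
  refine ⟨⟨θ, hcont⟩, fun x => ?_⟩
  by_cases hxv : x = v
  · have h2 : x ≠ -v := hxv ▸ hvne
    simp only [ContinuousMap.coe_mk, hθ₂ h2, Circle.exp_add, hc, mul_one, h₂ x h2]
  · simp only [ContinuousMap.coe_mk, hθ₁ hxv, h₁ x hxv]

end CircleLift

theorem exists_circleExp_comp_eq_sphereThree (g : C(SphereThree, Circle)) :
    ∃ θ : C(SphereThree, ℝ), ∀ x, Circle.exp (θ x) = g x := by
  refine exists_circleExp_comp_eq ?_ g
  have : Module.finrank ℝ (EuclideanSpace ℂ (Fin 2)) = 4 := by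
    rw [← Module.finrank_mul_finrank ℝ ℂ (EuclideanSpace ℂ (Fin 2))]
    simp
  omega

theorem nullhomotopic_sphereThree_circle (g : C(SphereThree, Circle)) : g.Nullhomotopic := by
  obtain ⟨θ, hθ⟩ := exists_circleExp_comp_eq_sphereThree g
  have : g = Circle.exp.comp ((ContinuousMap.id ℝ).comp θ) := by
    ext x; simp [hθ]
  rw [this]
  exact ((id_nullhomotopic ℝ).comp_left θ).comp_right _

-- Diagonal unitaries and failure of diagonalization

section Diagonal

/-- Sums `∑ i, c_i p_i` with circle-valued continuous coefficients `c_i = exp (i t θ_i)` along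
mutually orthogonal idempotents. -/
noncomputable def expSum {Y : Type*} [TopologicalSpace Y] {n : ℕ} (θ : Fin n → C(Y, ℝ))
    (p : Fin n → C(Y, MatC n)) (t : ℝ) : C(Y, MatC n) :=
  diagonalSum (fun i => Circle.exp.comp (t • θ i)) p circleCoord

variable {Y : Type*} [TopologicalSpace Y] {n : ℕ} {θ : Fin n → C(Y, ℝ)} {p : Fin n → C(Y, MatC n)}

theorem expSum_apply (t : ℝ) (y : Y) :
    expSum θ p t y = ∑ i, Complex.exp (t * θ i y * Complex.I) • p i y := by
  have h : ∀ z : Circle, circleCoord z = z := fun _ => rfl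
  simp [expSum, diagonalSum, ContinuousMap.coe_sum, h]

theorem expSum_zero : expSum θ p 0 = ∑ i, p i := by
  ext1 y
  simp [expSum_apply]

theorem expSum_mul_expSum (hp : ∀ i, p i * p i = p i) (hpq : Pairwise fun i j => p i * p j = 0)
    (s t : ℝ) : expSum θ p s * expSum θ p t = expSum θ p (s + t) := by
  ext1 y
  rw [ContinuousMap.mul_apply, expSum_apply, expSum_apply, expSum_apply, Finset.sum_mul_sum]
  refine Finset.sum_congr rfl fun i _ => ?_
  rw [Finset.sum_eq_single i]
  · have := congrArg (fun f => f y) (hp i)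
    simp only [ContinuousMap.mul_apply] at this
    rw [smul_mul_smul_comm, this, ← Complex.exp_add]
    congr 2
    push_cast
    ring
  · intro j _ hj
    have := congrArg (fun f => f y) (hpq hj.symm)
    simp only [ContinuousMap.mul_apply, ContinuousMap.zero_apply] at this
    rw [smul_mul_smul_comm, this, smul_zero]
  · simp

theorem continuous_expSum : Continuous (expSum θ p) := by
  refine ContinuousMap.continuous_of_continuous_uncurry _ ?_
  have : (Function.uncurry fun t y => expSum θ p t y) =
      fun z : ℝ × Y => ∑ i, Complex.exp (z.1 * θ i z.2 * Complex.I) • p i z.2 := by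
    ext1 z
    exact expSum_apply z.1 z.2
  rw [this]
  fun_prop

/-- If `∑ i, p_i = 1` then all the sums `∑ i, exp (i t θ_i) p_i` are invertible, by a path of
invertible elements from `1`. -/
theorem exists_units_eq_expSum_of_isClopen (hp : ∀ i, p i * p i = p i)
    (hpq : Pairwise fun i j => p i * p j = 0) (hsum : ∑ i, p i = 1) {G : Set C(Y, MatC n)ˣ}
    (hG : IsClopen G) (h1 : 1 ∈ G) : ∃ v ∈ G, (v : C(Y, MatC n)) = expSum θ p 1 := by
  let w : ℝ → C(Y, MatC n)ˣ := fun t => ⟨expSum θ p t, expSum θ p (-t),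
    by rw [expSum_mul_expSum hp hpq, add_neg_cancel, expSum_zero, hsum],
    by rw [expSum_mul_expSum hp hpq, neg_add_cancel, expSum_zero, hsum]⟩
  have hw : Continuous w := Units.continuous_iff.2
    ⟨continuous_expSum, continuous_expSum.comp continuous_neg⟩
  have hw0 : w 0 = 1 := Units.ext (by simp only [w, expSum_zero, hsum, Units.val_one])
  have huniv : w ⁻¹' G = Set.univ := (hG.preimage hw).eq_univ ⟨0, by simpa [hw0] using h1⟩
  exact ⟨w 1, (huniv ▸ Set.mem_univ (1 : ℝ) : (1 : ℝ) ∈ w ⁻¹' G), rfl⟩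

end Diagonal

theorem not_approximatelyDiagonalizable_of_apply_circleCoord
    (φ : C(Circle, ℂ) →⋆ₐ[ℂ] C(SphereThree, MatC 2)) (hφ : φ circleCoord = sphereMatrix) :
    ¬ ApproximatelyDiagonalizable φ := by
  intro h
  obtain ⟨α, p, hp, hpq, hF⟩ := h 1 one_pos {circleCoord} isCompact_singleton
  have hlt := hF _ rfl
  rw [hφ] at hlt
  have hidem : ∀ i, p i * p i = p i := fun i => (hp i).isStarProjection.isIdempotentElem
  choose θ hθ using fun i => exists_circleExp_comp_eq_sphereThree (α i)
  have hv : diagonalSum α p circleCoord = expSum θ p 1 := by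
    have : α = fun i => Circle.exp.comp ((1 : ℝ) • θ i) := by
      ext i y; simp [hθ]
    rw [expSum, ← this]
  rw [hv] at hlt
  let U : C(SphereThree, MatC 2)ˣ := Unitary.toUnits ⟨sphereMatrix, sphereMatrix_mem_unitary⟩
  have hU : (U : C(SphereThree, MatC 2)) = sphereMatrix := rfl
  have hUinv : ((U⁻¹ : C(SphereThree, MatC 2)ˣ) : C(SphereThree, MatC 2)) = star sphereMatrix := rfl
  have hnear : ‖star sphereMatrix * expSum θ p 1 - 1‖ < 1 := by
    have h1 : star sphereMatrix * expSum θ p 1 - 1 =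
        -(star sphereMatrix * (sphereMatrix - expSum θ p 1)) := by
      rw [mul_sub, (Unitary.mem_iff.1 sphereMatrix_mem_unitary).1]; abel
    rw [h1, norm_neg]
    exact (CStarRing.norm_mem_unitary_mul _ (Unitary.star_mem sphereMatrix_mem_unitary)).trans_lt hlt
  obtain ⟨W, hW⟩ : IsUnit (star sphereMatrix * expSum θ p 1) := by
    rw [← norm_neg, neg_sub] at hnear
    simpa using isUnit_one_sub_of_norm_lt_one hnear
  have hvu : expSum θ p 1 = ((U * W : C(SphereThree, MatC 2)ˣ) : C(SphereThree, MatC 2)) := by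
    rw [Units.val_mul, hW, hU, ← mul_assoc, (Unitary.mem_iff.1 sphereMatrix_mem_unitary).2, one_mul]
  -- `∑ p_i` acts as a left identity on `expSum θ p 1`, which is invertible because it is close to
  -- `u`; cancelling gives `1`.
  have hsum : ∑ i, p i = 1 := by
    have h1 := expSum_mul_expSum (θ := θ) hidem hpq 0 1
    rw [expSum_zero, zero_add, hvu] at h1
    exact (Units.mul_left_inj (U * W)).1 (h1.trans (one_mul _).symm)
  obtain ⟨v, hvG, hv'⟩ := exists_units_eq_expSum_of_isClopen (θ := θ) hidem hpq hsum
    (isClopen_extendableUnits (A := MatC 2)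
      (Metric.isClosed_sphere (x := (0 : EuclideanSpace ℂ (Fin 2))) (ε := 1)))
    (Subgroup.one_mem _)
  -- `W = u⋆ v` is within `1` of the identity, so it extends; then `u = v W⁻¹` would extend as well.
  have hWG := mem_extendableUnits_of_norm_sub_one_lt
    (Metric.isClosed_sphere (x := (0 : EuclideanSpace ℂ (Fin 2))) (ε := 1)) W (by rwa [hW])
  have hvUW : v = U * W := Units.ext (hv'.trans hvu)
  refine notMem_extendableUnits_of_eq_sphereMatrix hU ?_
  have := Subgroup.mul_mem _ hvG (Subgroup.inv_mem _ hWG)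
  rwa [hvUW, mul_inv_cancel_right] at this

-- Universal property of `C(𝕋)`

/-- The ⋆-subalgebra generated by the coordinate function is dense in `C(𝕋)`. -/
theorem topologicalClosure_adjoin_circleCoord :
    (StarAlgebra.adjoin ℂ {circleCoord}).topologicalClosure = ⊤ := by
  refine ContinuousMap.starSubalgebra_topologicalClosure_eq_top_of_separatesPoints _ ?_
  intro x y hxy
  exact ⟨circleCoord, ⟨circleCoord, StarAlgebra.subset_adjoin ℂ _ rfl, rfl⟩,
    fun h => hxy (Circle.ext h)⟩

open scoped CStarAlgebra in
/-- A unitary `u` of a C⋆-algebra is the image of the coordinate function under exactly one unital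
⋆-homomorphism from `C(𝕋)`. -/
theorem existsUnique_starAlgHom_apply_circleCoord {A : Type*} [CStarAlgebra A] {u : A}
    (hu : u ∈ unitary A) : ∃! φ : C(Circle, ℂ) →⋆ₐ[ℂ] A, φ circleCoord = u := by
  have hsub := spectrum.subset_circle_of_unitary (𝕜 := ℂ) hu
  have hn : IsStarNormal u := ⟨by
    rw [commute_iff_eq, (Unitary.mem_iff.1 hu).1, (Unitary.mem_iff.1 hu).2]⟩
  let ι : C(spectrum ℂ u, Circle) :=
    ⟨fun z => ⟨z.1, by simpa [Submonoid.unitSphere] using hsub z.2⟩, by fun_prop⟩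
  refine ⟨(cfcHom hn).comp (ContinuousMap.compStarAlgHom' ℂ ℂ ι), ?_, fun ψ hψ => ?_⟩
  · have : circleCoord.comp ι = (ContinuousMap.id ℂ).restrict (spectrum ℂ u) := by
      ext z; rfl
    simp only [StarAlgHom.comp_apply, ContinuousMap.compStarAlgHom'_apply, this]
    exact cfcHom_id hn
  · have hφ := cfcHom_id (R := ℂ) hn
    set φ := (cfcHom hn).comp (ContinuousMap.compStarAlgHom' ℂ ℂ ι) with hφdef
    have hφu : φ circleCoord = u := hφ
    have hcφ : Continuous φ := map_continuous φ
    have hcψ : Continuous ψ := map_continuous ψ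
    have hle : (StarAlgebra.adjoin ℂ {circleCoord}).topologicalClosure ≤
        StarAlgHom.equalizer ψ φ :=
      StarSubalgebra.topologicalClosure_minimal (StarAlgHom.adjoin_le_equalizer ψ φ
        (by simpa [Set.EqOn] using hψ.trans hφu.symm)) (isClosed_eq hcψ hcφ)
    rw [topologicalClosure_adjoin_circleCoord] at hle
    exact StarAlgHom.ext fun f => hle trivial

theorem corollary7p4 :
    (∃! φ : C(Circle, ℂ) →⋆ₐ[ℂ] C(SphereThree, MatC 2), φ circleCoord = sphereMatrix) ∧
    (∀ φ : C(Circle, ℂ) →⋆ₐ[ℂ] C(SphereThree, MatC 2), φ circleCoord = sphereMatrix →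
      ¬ ApproximatelyDiagonalizable φ) ∧
    (∃ hu : sphereMatrix ∈ unitary C(SphereThree, MatC 2),
      (⟨sphereMatrix, hu⟩ : unitary C(SphereThree, MatC 2)) ∉
        connectedComponent (1 : unitary C(SphereThree, MatC 2))) ∧
    (∀ g : C(SphereThree, Circle), g.Nullhomotopic) :=
  ⟨existsUnique_starAlgHom_apply_circleCoord sphereMatrix_mem_unitary,
    not_approximatelyDiagonalizable_of_apply_circleCoord,
    ⟨sphereMatrix_mem_unitary, sphereMatrix_notMem_connectedComponent_one⟩,
    nullhomotopic_sphereThree_circle⟩
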